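/- Let $(\mathcal M,\otimes,\mathbb I)$ be a locally small (each object has only a set of subobjects), bicomplete abelian monoidal category whose tensor product is additive and right exact in each variable, and which is Penrose: the left and right actions of $\mathrm{End}(\mathbb I)$ on each group $\mathrm{Hom}_{\mathcal M}(X,Y)$ coincide. Put $\mathcal Z=\mathrm{Hom}_{\mathcal M}(\mathbb I,-)$, with values in $\mathcal Z(\mathbb I)$-modules. Let $(A,m,u)$ be a monoid in $\mathcal M$. Then $\mathcal Z(A)$ is a $\mathcal Z(\mathbb I)$-algebra under the convolution product $f*g=m\circ(f\otimes g)$ (unit constraint omitted), with unit $u$. For $z\in\mathcal Z(A)$ and a morphism $h:X\to A$ write $z\triangleright h=m\circ(z\otimes h)$ and $h\triangleleft z=m\circ(h\otimes z)$, regarded as morphisms $X\to A$. For maps $\sigma,\delta:\mathcal Z(A)\to\mathcal Z(A)$ let ${}_\sigma J_\delta\hookrightarrow A$ be the intersection, over all $t\in\mathcal Z(A)$, of the equalizers of $\sigma(t)\triangleright A$ and $A\triangleleft\delta(t)$. The multiplication and unit of $A$ induce morphisms ${}_\sigma J_\delta\otimes{}_\delta J_\gamma\to{}_\sigma J_\gamma$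 and $u_\sigma:\mathbb I\to{}_\sigma J_\sigma$; in particular each ${}_\sigma J_\sigma$ is a monoid, and there are induced morphisms $\overline m{}^{\delta}_{\sigma,\gamma}:{}_\sigma J_\delta\otimes_{{}_\delta J_\delta}{}_\delta J_\gamma\to{}_\sigma J_\gamma$. An index $1$ stands for the identity map. Let $$\mathcal G(\mathcal Z(A))=\{\theta\in\mathrm{Aut}_{\mathcal Z(\mathbb I)\text{-alg}}(\mathcal Z(A)) : \overline m{}^{1}_{\theta,\theta}\text{ and }\overline m{}^{\theta}_{1,1}\text{ are isomorphisms}\}.$$ Let $\mathrm{Inv}_{\mathbb I}(A)$ be the set of subobjects $i_X:X\hookrightarrow A$ for which there are a subobject $i_Y:Y\hookrightarrow A$ and isomorphisms $m_X:X\otimes Y\to\mathbb I$, $m_Y:Y\otimes X\to\mathbb I$ with $u\circ m_X=m\circ(i_X\otimes i_Y)$ and $u\circ m_Y=m\circ(i_Y\otimes i_X)$. If $u$ is a monomorphism it is a group, the product of $X$ and $X'$ being $X\otimes X'$ with the monomorphism $m\circ(i_X\otimes i_{X'})$ and the neutral element being $u:\mathbb I\hookrightarrow A$; the formula $\Phi_X(t)=m\circ(i_X\otimes(t\triangleright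 i_Y))\circ m_X^{-1}$ then defines a group homomorphism $\Phi:\mathrm{Inv}_{\mathbb I}(A)\to\mathrm{Aut}_{\mathcal Z(\mathbb I)\text{-alg}}(\mathcal Z(A))$, $X\mapsto\Phi_X$ (the Miyashita action). Let $\mathrm{Aut}_{alg}(A)$ be the group of monoid automorphisms of $A$, and $\Omega:\mathrm{Aut}_{alg}(A)\to\mathrm{Aut}_{\mathcal Z(\mathbb I)\text{-alg}}(\mathcal Z(A))$ the group homomorphism $\gamma\mapsto\mathcal Z(\gamma)=(z\mapsto\gamma\circ z)$. **Theorem.** Assume that $A$ is right flat (the functor $A\otimes-$ is left exact), that $A\otimes A\sim A$ (each is, as an $A$-bimodule, a direct summand of a finite direct sum of copies of the other), and that $u_1:\mathbb I\to{}_1J_1$ is an isomorphism (so that $u$ is a monomorphism). Then $\mathcal G(\mathcal Z(A))$ is a subgroup of $\mathrm{Aut}_{\mathcal Z(\mathbb I)\text{-alg}}(\mathcal Z(A))$, with inclusion $\varsigma$, and $\Omega=\varsigma\circ\omega$ for a group homomorphism $\omega:\mathrm{Aut}_{alg}(A)\to\mathcal G(\mathcal Z(A))$. Moreover: 1. If $\Omega$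 is surjective, then $\varsigma$ and $\Phi$ are bijective. 2. If $\Omega$ is surjective and $\mathcal Z$ is faithful, then $\Omega$ and $\omega$ are bijective, and there are isomorphisms of groups $$\mathrm{Inv}_{\mathbb I}(A)\cong\mathrm{Aut}_{\mathcal Z(\mathbb I)\text{-alg}}(\mathcal Z(A))\cong\mathrm{Aut}_{alg}(A)\cong\mathcal G(\mathcal Z(A)).$$ -/

import Mathlib

open CategoryTheory CategoryTheory.Limits CategoryTheory.MonoidalCategory

universe v u

namespace Miyashita

open MonObj

noncomputable section

/-- A monoidal category is *Penrose* if the left and the right actions of the scalars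
`t : 𝟙_ C ⟶ 𝟙_ C` on every hom-set coincide (the hom-groups are central bimodules over the
endomorphism ring of the unit object). -/
class Penrose (C : Type u) [Category.{v} C] [MonoidalCategory C] : Prop where
  central : ∀ (t : 𝟙_ C ⟶ 𝟙_ C) {X Y : C} (f : X ⟶ Y),
    (λ_ X).inv ≫ (t ⊗ₘ f) ≫ (λ_ Y).hom = (ρ_ X).inv ≫ (f ⊗ₘ t) ≫ (ρ_ Y).hom

section Products

variable {C : Type u} [Category.{v} C] [MonoidalCategory C] {A : C} [MonObj A]

/-- The product `m ∘ (f ⊗ g)` of two morphisms into a monoid. -/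
def conv {X Y : C} (f : X ⟶ A) (g : Y ⟶ A) : X ⊗ Y ⟶ A := (f ⊗ₘ g) ≫ μ[A]

/-- The left action `z ▷ h = m ∘ (z ⊗ h) ∘ l⁻¹` of `z : 𝟙_ C ⟶ A` on morphisms into `A`. -/
def lact {X : C} (z : 𝟙_ C ⟶ A) (h : X ⟶ A) : X ⟶ A := (λ_ X).inv ≫ conv z h

/-- The right action `h ◁ z = m ∘ (h ⊗ z) ∘ r⁻¹` of `z : 𝟙_ C ⟶ A` on morphisms into `A`. -/
def ract {X : C} (h : X ⟶ A) (z : 𝟙_ C ⟶ A) : X ⟶ A := (ρ_ X).inv ≫ conv h z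

theorem tensor_conv {X Y X' Y' : C} (a : X' ⟶ X) (b : Y' ⟶ Y) (f : X ⟶ A) (g : Y ⟶ A) :
    (a ⊗ₘ b) ≫ conv f g = conv (a ≫ f) (b ≫ g) := by
  simp [conv]

theorem whiskerRight_conv {X Y X' : C} (a : X' ⟶ X) (f : X ⟶ A) (g : Y ⟶ A) :
    a ▷ Y ≫ conv f g = conv (a ≫ f) g := by
  rw [← tensorHom_id, tensor_conv, Category.id_comp]

theorem whiskerLeft_conv {X Y Y' : C} (b : Y' ⟶ Y) (f : X ⟶ A) (g : Y ⟶ A) :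
    X ◁ b ≫ conv f g = conv f (b ≫ g) := by
  rw [← id_tensorHom, tensor_conv, Category.id_comp]

theorem conv_assoc {X Y Z : C} (f : X ⟶ A) (g : Y ⟶ A) (h : Z ⟶ A) :
    (α_ X Y Z).hom ≫ conv f (conv g h) = conv (conv f g) h := by
  have e1 : conv f (conv g h) = (f ⊗ₘ (g ⊗ₘ h)) ≫ A ◁ μ[A] ≫ μ[A] := by
    simp [conv, ← id_tensorHom]
  have e2 : conv (conv f g) h = ((f ⊗ₘ g) ⊗ₘ h) ≫ μ[A] ▷ A ≫ μ[A] := by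
    rw [← tensorHom_id, tensorHom_comp_tensorHom_assoc, Category.comp_id, conv, conv]
  rw [e1, e2, MonObj.mul_assoc, ← associator_naturality_assoc]

theorem conv_assoc_inv {X Y Z : C} (f : X ⟶ A) (g : Y ⟶ A) (h : Z ⟶ A) :
    (α_ X Y Z).inv ≫ conv (conv f g) h = conv f (conv g h) := by
  rw [← conv_assoc, Iso.inv_hom_id_assoc]

theorem one_conv {X : C} (f : X ⟶ A) : conv η[A] f = (λ_ X).hom ≫ f := by
  simp [conv, MonoidalCategory.tensorHom_def']

theorem conv_one {X : C} (f : X ⟶ A) : conv f η[A] = (ρ_ X).hom ≫ f := by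
  simp [conv, MonoidalCategory.tensorHom_def]

theorem one_lact {X : C} (h : X ⟶ A) : lact η[A] h = h := by simp [lact, one_conv]

theorem ract_one {X : C} (h : X ⟶ A) : ract h η[A] = h := by simp [ract, conv_one]

theorem comp_lact {X Y : C} (a : Y ⟶ X) (z : 𝟙_ C ⟶ A) (h : X ⟶ A) :
    a ≫ lact z h = lact z (a ≫ h) := by
  simp only [lact, ← whiskerLeft_conv, leftUnitor_inv_naturality_assoc]

theorem comp_ract {X Y : C} (a : Y ⟶ X) (z : 𝟙_ C ⟶ A) (h : X ⟶ A) :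
    a ≫ ract h z = ract (a ≫ h) z := by
  simp only [ract, ← whiskerRight_conv, rightUnitor_inv_naturality_assoc]

theorem conv_lact {X Y : C} (z : 𝟙_ C ⟶ A) (f : X ⟶ A) (g : Y ⟶ A) :
    conv f (lact z g) = conv (ract f z) g := by
  rw [lact, ract, ← whiskerLeft_conv, ← whiskerRight_conv, ← conv_assoc, ← Category.assoc]
  congr 1
  monoidal_coherence

theorem lact_conv {X Y : C} (z : 𝟙_ C ⟶ A) (f : X ⟶ A) (g : Y ⟶ A) :
    lact z (conv f g) = conv (lact z f) g := by
  rw [lact, lact, ← whiskerRight_conv, ← conv_assoc, ← Category.assoc]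
  congr 1
  monoidal_coherence

theorem ract_conv {X Y : C} (z : 𝟙_ C ⟶ A) (f : X ⟶ A) (g : Y ⟶ A) :
    ract (conv f g) z = conv f (ract g z) := by
  rw [ract, ract, ← whiskerLeft_conv, ← conv_assoc, ← Category.assoc]
  congr 1
  monoidal_coherence

theorem lact_one (z : 𝟙_ C ⟶ A) : lact z η[A] = z := by
  rw [lact, conv_one, ← unitors_equal, Iso.inv_hom_id_assoc]

theorem one_ract (z : 𝟙_ C ⟶ A) : ract η[A] z = z := by
  rw [ract, one_conv, unitors_equal, Iso.inv_hom_id_assoc]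

theorem lact_eq_ract (z w : 𝟙_ C ⟶ A) : lact z w = ract z w := by
  rw [lact, ract, unitors_inv_equal]

theorem lact_lact {X : C} (z w : 𝟙_ C ⟶ A) (h : X ⟶ A) :
    lact z (lact w h) = lact (lact z w) h := by
  conv_lhs => rw [lact, conv_lact, ← lact_eq_ract, ← lact]

theorem lact_ract {X : C} (z w : 𝟙_ C ⟶ A) (h : X ⟶ A) :
    lact z (ract h w) = ract (lact z h) w := by
  rw [ract, ← comp_lact, lact_conv, ← ract]

theorem ract_ract {X : C} (z w : 𝟙_ C ⟶ A) (h : X ⟶ A) :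
    ract (ract h z) w = ract h (ract z w) := by
  rw [← lact_eq_ract, ract.eq_1 h (lact z w), conv_lact, ← ract]

theorem scalar_lact {X : C} (t : 𝟙_ C ⟶ 𝟙_ C) (h : X ⟶ A) :
    lact (t ≫ η[A]) h = (λ_ X).inv ≫ t ▷ X ≫ (λ_ X).hom ≫ h := by
  rw [lact, ← whiskerRight_conv, one_conv]

theorem scalar_lact_unit (t : 𝟙_ C ⟶ 𝟙_ C) (z : 𝟙_ C ⟶ A) : lact (t ≫ η[A]) z = t ≫ z := by
  rw [scalar_lact]
  simp [unitors_equal, unitors_inv_equal]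

theorem lact_scalar_unit (t : 𝟙_ C ⟶ 𝟙_ C) (z : 𝟙_ C ⟶ A) : lact z (t ≫ η[A]) = t ≫ z := by
  rw [← comp_lact, lact_one]

section Additive

variable [Preadditive C] [MonoidalPreadditive C]

theorem conv_add {X Y : C} (f : X ⟶ A) (g h : Y ⟶ A) : conv f (g + h) = conv f g + conv f h := by
  simp [conv, MonoidalPreadditive.tensor_add]

theorem add_conv {X Y : C} (f g : X ⟶ A) (h : Y ⟶ A) : conv (f + g) h = conv f h + conv g h := by
  simp [conv, MonoidalPreadditive.add_tensor]

theorem lact_add {X : C} (z : 𝟙_ C ⟶ A) (f g : X ⟶ A) : lact z (f + g) = lact z f + lact z g := by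
  simp [lact, conv_add]

theorem add_lact {X : C} (z w : 𝟙_ C ⟶ A) (f : X ⟶ A) : lact (z + w) f = lact z f + lact w f := by
  simp [lact, add_conv]

theorem zero_lact {X : C} (f : X ⟶ A) : lact (0 : 𝟙_ C ⟶ A) f = 0 := by simp [lact, conv]

theorem lact_zero {X : C} (z : 𝟙_ C ⟶ A) : lact z (0 : X ⟶ A) = 0 := by simp [lact, conv]

end Additive

theorem conv_comp_hom {B : C} [MonObj B] (κ : A ⟶ B) [IsMonHom κ] {X Y : C}
    (f : X ⟶ A) (g : Y ⟶ A) : conv f g ≫ κ = conv (f ≫ κ) (g ≫ κ) := by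
  simp [conv]

theorem lact_comp_hom {B : C} [MonObj B] (κ : A ⟶ B) [IsMonHom κ] {X : C}
    (z : 𝟙_ C ⟶ A) (f : X ⟶ A) : lact z f ≫ κ = lact (z ≫ κ) (f ≫ κ) := by
  rw [lact, lact, Category.assoc, conv_comp_hom]

end Products

/-! ### The functor `Z = Hom(𝟙, -)` and the algebra of invariants `Z(A)` -/

/-- The ring `Z(𝟙)` of endomorphisms of the unit object. -/
abbrev ZUnit (C : Type u) [Category.{v} C] [MonoidalCategory C] := End (𝟙_ C)

/-- The underlying set `Hom(𝟙, A)` of `Z(A)`. -/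
def Z {C : Type u} [Category.{v} C] [MonoidalCategory C] (A : C) : Type v := 𝟙_ C ⟶ A

section Algebra

variable {C : Type u} [Category.{v} C] [MonoidalCategory C]

theorem scalar_comm (s t : 𝟙_ C ⟶ 𝟙_ C) : s ≫ t = t ≫ s := by
  have h := whisker_exchange s t
  simp only [id_whiskerLeft, whiskerRight_id] at h
  rw [unitors_equal, unitors_inv_equal] at h
  simpa using h.symm

variable [Preadditive C]

instance : CommRing (ZUnit C) :=
  { (inferInstance : Ring (End (𝟙_ C))) with
    mul_comm := fun s t => scalar_comm t s }

instance (A : C) : AddCommGroup (Z A) := inferInstanceAs (AddCommGroup (𝟙_ C ⟶ A))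

variable [MonoidalPreadditive C] (A : C) [MonObj A]

/-- The convolution ring structure on `Z(A)`: the product of `f` and `g` is
`m ∘ (f ⊗ g) ∘ l⁻¹`, the unit is the unit of the monoid `A`. -/
instance : Ring (Z A) :=
  { (inferInstance : AddCommGroup (Z A)) with
    mul := fun f g => lact (A := A) f g
    one := (η[A] : 𝟙_ C ⟶ A)
    one_mul := fun f => one_lact (A := A) f
    mul_one := fun f => lact_one (A := A) f
    mul_assoc := fun f g h => (lact_lact (A := A) f g h).symm
    left_distrib := fun f g h => lact_add (A := A) f g h
    right_distrib := fun f g h => add_lact (A := A) f g h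
    zero_mul := fun f => zero_lact (A := A) f
    mul_zero := fun f => lact_zero (A := A) f }

/-- `Z(A)` is an algebra over `Z(𝟙)` through `Z(u)`, `t ↦ u ∘ t`; the scalar `t` acts on `f`
by `f ∘ t`. -/
instance : Algebra (ZUnit C) (Z A) where
  smul t f := ((t : 𝟙_ C ⟶ 𝟙_ C) ≫ (f : 𝟙_ C ⟶ A) : 𝟙_ C ⟶ A)
  algebraMap :=
    { toFun := fun t => ((t : 𝟙_ C ⟶ 𝟙_ C) ≫ η[A] : 𝟙_ C ⟶ A)
      map_one' := Category.id_comp _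
      map_mul' := fun s t => by
        change (t ≫ s) ≫ η[A] = lact (A := A) (s ≫ η[A]) (t ≫ η[A])
        rw [← comp_lact, lact_one, Category.assoc]
      map_zero' := zero_comp
      map_add' := fun s t => Preadditive.add_comp _ _ _ s t _ }
  commutes' t f :=
    (scalar_lact_unit (A := A) t f).trans (lact_scalar_unit (A := A) t f).symm
  smul_def' t f := (scalar_lact_unit (A := A) t f).symm

/-- The group of `Z(𝟙)`-algebra automorphisms of `Z(A)` (with composition as product). -/
abbrev AutZ := Z A ≃ₐ[ZUnit C] Z A

/-- The group of automorphisms of the monoid `A` (with composition as product). -/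
abbrev AutAlg {C : Type u} [Category.{v} C] [MonoidalCategory C] (A : C) [MonObj A] :=
  Aut (Mon.mk A)

/-- The group homomorphism `Ω`, sending a monoid automorphism `κ` to `Z(κ) : z ↦ κ ∘ z`. -/
def Omega : AutAlg A →* AutZ A where
  toFun κ := AlgEquiv.ofRingEquiv (f :=
    { toFun := fun z => ((z : 𝟙_ C ⟶ A) ≫ κ.hom.hom : 𝟙_ C ⟶ A)
      invFun := fun z => ((z : 𝟙_ C ⟶ A) ≫ κ.inv.hom : 𝟙_ C ⟶ A)
      left_inv := fun z => by
        have h : κ.hom.hom ≫ κ.inv.hom = 𝟙 A :=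
          congrArg Mon.Hom.hom (Iso.hom_inv_id (C := Mon C) κ)
        exact (Category.assoc _ _ _).trans ((congrArg _ h).trans (Category.comp_id _))
      right_inv := fun z => by
        have h : κ.inv.hom ≫ κ.hom.hom = 𝟙 A :=
          congrArg Mon.Hom.hom (Iso.inv_hom_id (C := Mon C) κ)
        exact (Category.assoc _ _ _).trans ((congrArg _ h).trans (Category.comp_id _))
      map_mul' := fun z w => lact_comp_hom (A := A) (B := A) κ.hom.hom z w
      map_add' := fun z w => Preadditive.add_comp _ _ _ _ _ _ })
    (fun t => by
      change (t ≫ η[A]) ≫ κ.hom.hom = t ≫ η[A]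
      rw [Category.assoc, IsMonHom.one_hom])
  map_one' := by
    ext z
    exact Category.comp_id _
  map_mul' κ κ' := by
    ext z
    exact (Category.assoc _ _ _).symm

end Algebra

/-! ### Invertible subobjects -/

section Invertible

variable {C : Type u} [Category.{v} C] [MonoidalCategory C] {A : C} [MonObj A]

/-- Two morphisms `i : X ⟶ A` and `j : Y ⟶ A` are mutually inverse if the products
`m ∘ (i ⊗ j)` and `m ∘ (j ⊗ i)` factor through the unit of `A` by isomorphisms
`X ⊗ Y ≅ 𝟙` and `Y ⊗ X ≅ 𝟙`. -/
structure InvDatum {X Y : C} (i : X ⟶ A) (j : Y ⟶ A) where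
  mX : X ⊗ Y ≅ 𝟙_ C
  mY : Y ⊗ X ≅ 𝟙_ C
  hX : mX.hom ≫ η[A] = conv i j
  hY : mY.hom ≫ η[A] = conv j i

/-- A subobject `X` of `A` is (two-sided) invertible if it has a two-sided inverse subobject. -/
def IsInvertible (X : Subobject A) : Prop :=
  ∃ Y : Subobject A, Nonempty (InvDatum X.arrow Y.arrow)

variable (A) in
/-- The set of (two-sided) invertible subobjects of `A`. -/
def InvSub := { X : Subobject A // IsInvertible X }

namespace InvDatum

variable {X Y X' Y' : C} {i : X ⟶ A} {j : Y ⟶ A} {i' : X' ⟶ A} {j' : Y' ⟶ A}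

/-- Interchanging the two sides. -/
def symm (d : InvDatum i j) : InvDatum j i := ⟨d.mY, d.mX, d.hY, d.hX⟩

/-- Transport along isomorphisms of the sources. -/
def ofIso (d : InvDatum i j) (e : X' ≅ X) (f : Y' ≅ Y) (he : e.hom ≫ i = i')
    (hf : f.hom ≫ j = j') : InvDatum i' j' where
  mX := (e ⊗ᵢ f) ≪≫ d.mX
  mY := (f ⊗ᵢ e) ≪≫ d.mY
  hX := by simp [d.hX, tensor_conv, he, hf]
  hY := by simp [d.hY, tensor_conv, he, hf]

variable (A) in
/-- The unit of `A` is inverse to itself. -/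
def one : InvDatum (A := A) η[A] η[A] where
  mX := λ_ _
  mY := λ_ _
  hX := (one_conv _).symm
  hY := (one_conv _).symm

/-- The product of two invertible morphisms. -/
def mul (d : InvDatum i j) (d' : InvDatum i' j') : InvDatum (conv i i') (conv j' j) where
  mX := α_ X X' (Y' ⊗ Y) ≪≫ whiskerLeftIso X ((α_ X' Y' Y).symm ≪≫
    whiskerRightIso d'.mX Y ≪≫ λ_ Y) ≪≫ d.mX
  mY := α_ Y' Y (X ⊗ X') ≪≫ whiskerLeftIso Y' ((α_ Y X X').symm ≪≫
    whiskerRightIso d.mY X' ≪≫ λ_ X') ≪≫ d'.mY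
  hX := by
    rw [← conv_assoc, ← conv_assoc_inv i' j' j, ← d'.hX, ← whiskerRight_conv, one_conv]
    simp [d.hX, whiskerLeft_conv]
  hY := by
    rw [← conv_assoc, ← conv_assoc_inv j i i', ← d.hY, ← whiskerRight_conv, one_conv]
    simp [d'.hY, whiskerLeft_conv]

/-- Tensoring on the left with an invertible object is faithful. -/
theorem whiskerLeft_cancel (d : InvDatum i j) {P Q : C} {f g : P ⟶ Q}
    (h : Y ◁ f = Y ◁ g) : f = g := by
  have h' : (X ⊗ Y) ◁ f = (X ⊗ Y) ◁ g := by
    rw [tensor_whiskerLeft, tensor_whiskerLeft, h]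
  have h2 : 𝟙_ C ◁ f = 𝟙_ C ◁ g := by
    rw [← cancel_epi (d.mX.hom ▷ P), ← whisker_exchange, ← whisker_exchange, h']
  simpa using h2

/-- The morphism `m ∘ (i ⊗ A) : X ⊗ A ⟶ A` is a monomorphism. -/
theorem mono_conv_id (d : InvDatum i j) : Mono (conv i (𝟙 A)) := by
  constructor
  intro P f g h
  apply d.whiskerLeft_cancel
  have key : conv j (conv i (𝟙 A)) =
      (α_ Y X A).inv ≫ d.mY.hom ▷ A ≫ (λ_ A).hom := by
    rw [← conv_assoc_inv, ← d.hY, ← whiskerRight_conv, one_conv, Category.comp_id]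
  have h2 : Y ◁ f ≫ conv j (conv i (𝟙 A)) = Y ◁ g ≫ conv j (conv i (𝟙 A)) := by
    rw [whiskerLeft_conv, whiskerLeft_conv, h]
  rw [key] at h2
  exact (cancel_mono ((α_ Y X A).inv ≫ d.mY.hom ▷ A ≫ (λ_ A).hom)).1 h2

/-- Tensoring on the left with an invertible object preserves monomorphisms. -/
theorem mono_whiskerLeft (d : InvDatum i j) {P Q : C} (f : P ⟶ Q) [Mono f] : Mono (X ◁ f) := by
  constructor
  intro W a b h
  apply d.whiskerLeft_cancel
  have h2 : Y ◁ a ≫ Y ◁ X ◁ f = Y ◁ b ≫ Y ◁ X ◁ f := by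
    rw [← MonoidalCategory.whiskerLeft_comp, h, MonoidalCategory.whiskerLeft_comp]
  have key : Y ◁ X ◁ f = ((α_ Y X P).symm ≪≫ whiskerRightIso d.mY P ≪≫ λ_ P).hom ≫ f ≫
      ((α_ Y X Q).symm ≪≫ whiskerRightIso d.mY Q ≪≫ λ_ Q).inv := by
    rw [← Category.assoc, Iso.eq_comp_inv]
    simp only [Iso.trans_hom, Iso.symm_hom, whiskerRightIso_hom, Category.assoc]
    rw [← leftUnitor_naturality, ← whisker_exchange_assoc, tensor_whiskerLeft]
    simp
  rw [key] at h2
  simp only [← Category.assoc, cancel_mono] at h2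
  simpa using h2

/-- The product of an invertible morphism with a monomorphism is a monomorphism. -/
theorem mono_conv (d : InvDatum i j) [Mono i'] : Mono (conv i i') := by
  have h : conv i i' = X ◁ i' ≫ conv i (𝟙 A) := by rw [whiskerLeft_conv, Category.comp_id]
  rw [h]
  have := d.mono_conv_id
  have := d.mono_whiskerLeft i'
  exact mono_comp _ _

/-- The automorphism attached to an invertible morphism: `t ↦ m ∘ (i ⊗ (t ▷ j)) ∘ (m_X)⁻¹`. -/
def sigma (d : InvDatum i j) (t : 𝟙_ C ⟶ A) : 𝟙_ C ⟶ A := d.mX.inv ≫ conv i (lact t j)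

theorem compat (d : InvDatum i j) [Mono i] :
    d.mX.hom ▷ X ≫ (λ_ X).hom = (α_ X Y X).hom ≫ X ◁ d.mY.hom ≫ (ρ_ X).hom := by
  rw [← cancel_mono i]
  simp only [Category.assoc]
  rw [← one_conv, ← conv_one, whiskerRight_conv, whiskerLeft_conv, d.hX, d.hY, conv_assoc]

theorem lact_sigma (d : InvDatum i j) [Mono i] (t : 𝟙_ C ⟶ A) :
    lact (d.sigma t) i = ract i t := by
  have h : conv (conv i (lact t j)) i = (d.mX.hom ▷ X ≫ (λ_ X).hom) ≫ ract i t := by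
    rw [← conv_assoc, ← lact_conv, ← d.hY, ← comp_lact, lact_one, ← whiskerLeft_conv, d.compat,
      ract]
    simp
  rw [lact, sigma, ← whiskerRight_conv, h]
  simp

theorem sigma_unique (d : InvDatum i j) {s t : 𝟙_ C ⟶ A} (h : lact s i = ract i t) :
    d.sigma t = s := by
  rw [sigma, conv_lact, ← h, ← lact_conv, ← d.hX, comp_lact, Iso.inv_hom_id_assoc, lact_one]

theorem sigma_symm (d : InvDatum i j) [Mono i] (t : 𝟙_ C ⟶ A) : d.symm.sigma (d.sigma t) = t := by
  change d.mY.inv ≫ conv j (lact (d.sigma t) i) = t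
  rw [lact_sigma, ← ract_conv, ← d.hY, comp_ract, Iso.inv_hom_id_assoc, one_ract]

theorem sigma_lact (d : InvDatum i j) [Mono i] (s t : 𝟙_ C ⟶ A) :
    d.sigma (lact s t) = lact (d.sigma s) (d.sigma t) := by
  apply d.sigma_unique
  rw [← lact_lact, lact_sigma, lact_ract, lact_sigma, lact_eq_ract, ract_ract]

theorem sigma_add [Preadditive C] [MonoidalPreadditive C] (d : InvDatum i j) (s t : 𝟙_ C ⟶ A) :
    d.sigma (s + t) = d.sigma s + d.sigma t := by
  simp [sigma, add_lact, conv_add]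

theorem sigma_scalar [Penrose C] (d : InvDatum i j) (t : 𝟙_ C ⟶ 𝟙_ C) :
    d.sigma (t ≫ η[A]) = t ≫ η[A] := by
  apply d.sigma_unique
  have h := Penrose.central t (𝟙 X)
  simp only [tensorHom_id, id_tensorHom] at h
  rw [lact, ract, ← whiskerRight_conv, ← whiskerLeft_conv, one_conv, conv_one]
  simpa using congr($h ≫ i)

end InvDatum

section Group

/-- The product of `X` and `X'` in `InvSub A` is `X ⊗ X'` with the monomorphism
`m ∘ (i_X ⊗ i_X')`. -/
instance : Mul (InvSub A) where
  mul X X' := by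
    refine ⟨@Subobject.mk _ _ _ _ (conv X.1.arrow X'.1.arrow)
      (X.2.choose_spec.some.mono_conv), ?_⟩
    obtain ⟨Y, ⟨d⟩⟩ := X.2
    obtain ⟨Y', ⟨d'⟩⟩ := X'.2
    have := d.mono_conv (i' := X'.1.arrow)
    have := d'.symm.mono_conv (i' := Y.arrow)
    exact ⟨Subobject.mk (conv Y'.arrow Y.arrow), ⟨(d.mul d').ofIso (Subobject.underlyingIso _)
      (Subobject.underlyingIso _) (by simp) (by simp)⟩⟩

instance (X X' : InvSub A) : Mono (conv X.1.arrow X'.1.arrow) :=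
  X.2.choose_spec.some.mono_conv

theorem mul_val (X X' : InvSub A) : (X * X').1 = Subobject.mk (conv X.1.arrow X'.1.arrow) := rfl

variable [Mono η[A]]

/-- The unit object, as a subobject through the unit of `A`. -/
instance : One (InvSub A) :=
  ⟨⟨Subobject.mk η[A], Subobject.mk η[A], ⟨(InvDatum.one A).ofIso (Subobject.underlyingIso _)
    (Subobject.underlyingIso _) (by simp) (by simp)⟩⟩⟩

theorem one_val : (1 : InvSub A).1 = Subobject.mk η[A] := rfl

instance : Inhabited (InvSub A) := ⟨1⟩

/-- The inverse of `X` is its inverse subobject. -/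
instance : Inv (InvSub A) where
  inv X := ⟨X.2.choose, X.1, ⟨X.2.choose_spec.some.symm⟩⟩

/-- The group of invertible subobjects of `A`. -/
instance : Group (InvSub A) := Group.ofLeftAxioms
  (fun X X' X'' => by
    apply Subtype.ext
    change Subobject.mk (conv (X * X').1.arrow X''.1.arrow) =
      Subobject.mk (conv X.1.arrow (X' * X'').1.arrow)
    refine Subobject.mk_eq_mk_of_comm _ _
      (whiskerRightIso (Subobject.underlyingIso (conv X.1.arrow X'.1.arrow)) _ ≪≫ α_ _ _ _ ≪≫
        whiskerLeftIso _ (Subobject.underlyingIso (conv X'.1.arrow X''.1.arrow)).symm) ?_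
    simp only [Iso.trans_hom, whiskerLeftIso_hom, Iso.symm_hom, whiskerRightIso_hom,
      Category.assoc]
    erw [whiskerLeft_conv, Subobject.underlyingIso_arrow, conv_assoc, whiskerRight_conv,
      Subobject.underlyingIso_hom_comp_eq_mk]
    rfl)
  (fun X => by
    apply Subtype.ext
    rw [mul_val]
    conv_rhs => rw [← Subobject.mk_arrow X.1]
    refine Subobject.mk_eq_mk_of_comm _ _
      (whiskerRightIso (Subobject.underlyingIso η[A]) _ ≪≫ λ_ _) ?_
    simp only [Iso.trans_hom, whiskerRightIso_hom, Category.assoc]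
    rw [← one_conv, whiskerRight_conv, Subobject.underlyingIso_hom_comp_eq_mk]
    rfl)
  (fun X => by
    apply Subtype.ext
    rw [mul_val, one_val]
    exact Subobject.mk_eq_mk_of_comm _ _ X.2.choose_spec.some.mY X.2.choose_spec.some.hY)

variable [Preadditive C] [MonoidalPreadditive C] [Penrose C]

/-- The algebra automorphism attached to mutually inverse monomorphisms into `A`. -/
def InvDatum.autZ {X Y : C} {i : X ⟶ A} {j : Y ⟶ A} (d : InvDatum i j) [Mono i] [Mono j] :
    AutZ A := AlgEquiv.ofRingEquiv (f :=
    { toFun := fun z => (d.sigma z : 𝟙_ C ⟶ A)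
      invFun := fun z => (d.symm.sigma z : 𝟙_ C ⟶ A)
      left_inv := fun z => d.sigma_symm z
      right_inv := fun z => d.symm.sigma_symm z
      map_mul' := fun z w => d.sigma_lact z w
      map_add' := fun z w => d.sigma_add z w })
    (fun t => d.sigma_scalar t)

variable (A) in
/-- The Miyashita action `Φ : InvSub(A) → Aut(Z(A))`, sending `X` with inverse `Y` to
`t ↦ m ∘ (i_X ⊗ (t ▷ i_Y)) ∘ (m_X)⁻¹`. -/
def Phi : InvSub A →* AutZ A where
  toFun X := (X.2.choose_spec.some).autZ
  map_one' := AlgEquiv.ext fun z => InvDatum.sigma_unique _ (by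
    have h : ∀ t : 𝟙_ C ⟶ A,
        lact t (Subobject.mk η[A]).arrow = ract (Subobject.mk η[A]).arrow t := fun t => by
      rw [← Subobject.underlyingIso_hom_comp_eq_mk, ← comp_lact, ← comp_ract, lact_one, one_ract]
    exact h z)
  map_mul' X X' := AlgEquiv.ext fun z => InvDatum.sigma_unique _ (by
    have h : ∀ (d : InvDatum X.1.arrow X.2.choose.arrow)
        (d' : InvDatum X'.1.arrow X'.2.choose.arrow) (t : 𝟙_ C ⟶ A),
        lact (d.sigma (d'.sigma t)) (Subobject.mk (conv X.1.arrow X'.1.arrow)).arrow =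
          ract (Subobject.mk (conv X.1.arrow X'.1.arrow)).arrow t := fun d d' t => by
      rw [← Subobject.underlyingIso_hom_comp_eq_mk, ← comp_lact, ← comp_ract, lact_conv,
        d.lact_sigma, ← conv_lact, d'.lact_sigma, ract_conv]
    exact h _ _ z)

/-- The value of `Φ` does not depend on the chosen inverse. -/
theorem Phi_apply (X : InvSub A) {Y : Subobject A} (d : InvDatum X.1.arrow Y.arrow) (t : 𝟙_ C ⟶ A) :
    Phi A X t = d.sigma t :=
  InvDatum.sigma_unique _ (d.lact_sigma t)

end Group

end Invertible

/-! ### The subobjects `J σ δ` -/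

section J

variable {C : Type u} [Category.{v} C] [Abelian C] [MonoidalCategory C]
  [WellPowered.{v} C] [HasLimits C] {A : C} [MonObj A]

/-- The intersection over all `t` in `Z(A)` of the equalizers of `σ(t) ▷ A` and `A ◁ δ(t)`. -/
def J (σ δ : (𝟙_ C ⟶ A) → (𝟙_ C ⟶ A)) : Subobject A :=
  Subobject.sInf.{v} (Set.range fun t : 𝟙_ C ⟶ A =>
    equalizerSubobject (lact (σ t) (𝟙 A)) (ract (𝟙 A) (δ t)))

/-- The universal property of `J σ δ`. -/
theorem J_factors_iff (σ δ : (𝟙_ C ⟶ A) → (𝟙_ C ⟶ A)) {X : C} (f : X ⟶ A) :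
    (J σ δ).Factors f ↔ ∀ t : 𝟙_ C ⟶ A, lact (σ t) f = ract f (δ t) := by
  have key : ∀ t : 𝟙_ C ⟶ A,
      (equalizerSubobject (lact (σ t) (𝟙 A)) (ract (𝟙 A) (δ t))).Factors f ↔
        lact (σ t) f = ract f (δ t) := fun t => by
    rw [equalizerSubobject_factors_iff, comp_lact, comp_ract, Category.comp_id]
  constructor
  · intro h t
    rw [← key]
    exact Subobject.factors_of_le f (Subobject.sInf_le.{v} _ _ (Set.mem_range_self t)) h
  · intro h
    have hle : imageSubobject f ≤ J σ δ := by
      refine Subobject.le_sInf.{v} _ _ ?_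
      rintro _ ⟨t, rfl⟩
      exact imageSubobject_le f _ (Subobject.factorThru_arrow _ f ((key t).2 (h t)))
    refine Subobject.factors_of_le f hle ?_
    simpa using imageSubobject_factors_comp_self f (𝟙 X)

theorem lact_J_arrow (σ δ : (𝟙_ C ⟶ A) → (𝟙_ C ⟶ A)) (t : 𝟙_ C ⟶ A) :
    lact (σ t) (J σ δ).arrow = ract (J σ δ).arrow (δ t) :=
  (J_factors_iff σ δ _).1 (Subobject.factors_self _) t

/-- The multiplication `J σ δ ⊗ J δ κ ⟶ J σ κ` induced by that of `A`. -/
def mulJ (σ δ κ : (𝟙_ C ⟶ A) → (𝟙_ C ⟶ A)) : (J σ δ : C) ⊗ (J δ κ : C) ⟶ (J σ κ : C) :=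
  (J σ κ).factorThru (conv (J σ δ).arrow (J δ κ).arrow) (by
    rw [J_factors_iff]
    intro t
    rw [lact_conv, lact_J_arrow, ← conv_lact, lact_J_arrow, ract_conv])

theorem mulJ_arrow (σ δ κ : (𝟙_ C ⟶ A) → (𝟙_ C ⟶ A)) :
    mulJ σ δ κ ≫ (J σ κ).arrow = conv (J σ δ).arrow (J δ κ).arrow :=
  Subobject.factorThru_arrow _ _ _

/-- The unit `u_σ : 𝟙 ⟶ J σ σ` induced by that of `A`. -/
def unitJ (σ : (𝟙_ C ⟶ A) → (𝟙_ C ⟶ A)) : 𝟙_ C ⟶ (J σ σ : C) :=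
  (J σ σ).factorThru η[A] (by
    rw [J_factors_iff]
    intro t
    rw [lact_one, one_ract])

theorem unitJ_arrow (σ : (𝟙_ C ⟶ A) → (𝟙_ C ⟶ A)) : unitJ σ ≫ (J σ σ).arrow = η[A] :=
  Subobject.factorThru_arrow _ _ _

/-- If `u_1 : 𝟙 ⟶ J 1 1` is an isomorphism then the unit of `A` is a monomorphism. -/
instance mono_one_of_isIso_unitJ [IsIso (unitJ (A := A) id)] : Mono η[A] := by
  rw [← unitJ_arrow (A := A) id]
  exact mono_comp _ _

theorem mulJ_assoc (σ δ κ ε : (𝟙_ C ⟶ A) → (𝟙_ C ⟶ A)) :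
    mulJ σ δ κ ▷ (J κ ε : C) ≫ mulJ σ κ ε =
      (α_ _ _ _).hom ≫ (J σ δ : C) ◁ mulJ δ κ ε ≫ mulJ σ δ ε := by
  rw [← cancel_mono (J σ ε).arrow]
  simp only [Category.assoc]
  rw [mulJ_arrow, mulJ_arrow, whiskerRight_conv, whiskerLeft_conv, mulJ_arrow, mulJ_arrow,
    conv_assoc]

/-- The tensor product of `J σ δ` and `J δ κ` over the monoid `J δ δ`, as a coequalizer. -/
def tensorJ (σ δ κ : (𝟙_ C ⟶ A) → (𝟙_ C ⟶ A)) : C :=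
  coequalizer (mulJ σ δ δ ▷ (J δ κ : C))
    ((α_ (J σ δ : C) (J δ δ : C) (J δ κ : C)).hom ≫ (J σ δ : C) ◁ mulJ δ δ κ)

/-- The morphism from the tensor product of `J σ δ` and `J δ κ` over `J δ δ` to `J σ κ` induced by
the multiplication. -/
def mulJBar (σ δ κ : (𝟙_ C ⟶ A) → (𝟙_ C ⟶ A)) : tensorJ σ δ κ ⟶ (J σ κ : C) :=
  coequalizer.desc (mulJ σ δ κ) (by rw [mulJ_assoc, Category.assoc])

variable [MonoidalPreadditive C]

variable (A) in
/-- The set of those automorphisms `θ` of `Z(A)` for which `J θ 1` is a two-sided invertible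
bimodule over `J 1 1 = J θ θ`, with inverse `J 1 θ`: both multiplication morphisms
`J θ 1 ⊗_{J 1 1} J 1 θ ⟶ J θ θ` and `J 1 θ ⊗_{J θ θ} J θ 1 ⟶ J 1 1` are isomorphisms. -/
def invertibleAuts : Set (AutZ A) :=
  { θ | IsIso (mulJBar (A := A) θ id θ) ∧ IsIso (mulJBar (A := A) id θ id) }

end J

/-! ### Bimodules -/

section Bimodules

variable {C : Type u} [Category.{v} C] [MonoidalCategory C]

/-- `A ⊗ A` as an `A`-bimodule, `A` acting by multiplication on the outer sides. -/
def tensorSelf (A : C) [MonObj A] : Bimod (Mon.mk A) (Mon.mk A) where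
  X := A ⊗ A
  actLeft := (α_ A A A).inv ≫ μ[A] ▷ A
  actRight := (α_ A A A).hom ≫ A ◁ μ[A]
  one_actLeft := by
    rw [associator_inv_naturality_left_assoc, ← comp_whiskerRight, MonObj.one_mul,
      leftUnitor_tensor_hom]
  left_assoc := by
    have h := MonObj.mul_assoc A
    simp only [MonoidalCategory.whiskerLeft_comp, Category.assoc]
    rw [associator_inv_naturality_left_assoc, ← comp_whiskerRight, h,
      associator_inv_naturality_middle_assoc]
    simp
  actRight_one := by
    rw [associator_naturality_right_assoc, ← MonoidalCategory.whiskerLeft_comp, MonObj.mul_one,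
      rightUnitor_tensor_hom]
  right_assoc := by
    have h : A ◁ μ[A] ≫ μ[A] = (α_ A A A).inv ≫ μ[A] ▷ A ≫ μ[A] := by
      rw [MonObj.mul_assoc, Iso.inv_hom_id_assoc]
    simp only [comp_whiskerRight, Category.assoc]
    rw [associator_naturality_right_assoc, ← MonoidalCategory.whiskerLeft_comp, h,
      associator_naturality_middle_assoc]
    simp only [MonoidalCategory.whiskerLeft_comp, ← Category.assoc]
    congr 2
    monoidal_coherence
  middle_assoc := by
    have h : (α_ A A (A ⊗ A)).inv ≫ μ[A] ▷ (A ⊗ A) ≫ A ◁ μ[A] =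
        A ◁ A ◁ μ[A] ≫ (α_ A A A).inv ≫ μ[A] ▷ A := by
      rw [← whisker_exchange, tensor_whiskerLeft]
      simp
    simp only [comp_whiskerRight, MonoidalCategory.whiskerLeft_comp, Category.assoc]
    rw [← h, associator_naturality_left_assoc]
    simp only [← Category.assoc]
    congr 2
    monoidal_coherence

/-- `M` divides `N`: there are `k ≥ 1` and bimodule morphisms `f i : M ⟶ N`, `g i : N ⟶ M`
(`i = 1, …, k`) with `∑ g i ∘ f i = id`, that is, `M` is a direct summand of a finite direct sum
of copies of `N`. -/
def DividesBimod [Preadditive C] {R S : Mon C} (M N : Bimod R S) : Prop :=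
  ∃ (k : ℕ) (_ : 1 ≤ k) (f : Fin k → (M ⟶ N)) (g : Fin k → (N ⟶ M)),
    ∑ i, (f i).hom ≫ (g i).hom = 𝟙 M.X

/-- `M ∼ N`: each divides the other. -/
def SimilarBimod [Preadditive C] {R S : Mon C} (M N : Bimod R S) : Prop :=
  DividesBimod M N ∧ DividesBimod N M

end Bimodules

end

end Miyashita

open Miyashita

/-! The set `invertibleAuts A` is exactly the image of `Phi A`, hence a subgroup (`range_Phi`). If
`X` has inverse `Y` and `θ = Φ_X`, then `X` lies in `J θ 1` and `Y` in `J 1 θ`, so `𝟙 ≅ X ⊗ Y`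
provides a section of the product of these two subobjects, and likewise in the other order. Since
`θ` is surjective, `J θ θ = J 1 1`, which is the unit object; so the products form a Morita context
with values in `𝟙`, and split surjectivity forces both to be isomorphisms (`section_isInverse`).
Conversely, an inverse pair `J θ 1`, `J 1 θ` has Miyashita automorphism `θ`. If `Φ_X = 1`, then `X`
commutes with `Z(A)`, factors through the unit of `A` and equals it (`Phi_injective`).

It remains to put the image of `Ω` inside that of `Φ` (`Omega_mem_invertibleAuts`). Write a bimodule
map `A ⟶ A ⊗ A` as a Casimir element `e` (`a e = e a`), and a bimodule map `A ⊗ A ⟶ A` as `a ⊗ b ↦ a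
z b`. That `A ⊗ A` divides `A` reads `1 ⊗ 1 = ∑ zᵢ eᵢ`; applying an automorphism `κ` to the left
factor and multiplying gives `1 = ∑ κ(zᵢ) wᵢ`, where `wᵢ = κ(eᵢ¹) eᵢ²` satisfies `κ(t) wᵢ = wᵢ t`.
That `A` divides `A ⊗ A` gives a trace `x ↦ ∑ eᵢ¹ x zᵢ eᵢ²` onto the centre of `Z(A)` with value `1`
at `1`. The trace replaces the arbitrary coefficients `κ(zᵢ)` by central ones
(`exists_sum_mul_eq_one`), so `1` is a sum of products of intertwiners. These are global elements of
the `J`'s and yield the required sections. -/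

namespace Miyashita

/-! ### Intertwining elements in a ring with a trace -/

/-- If `1` is a combination of elements `θ`-commuting, resp. `θ⁻¹`-commuting, with the ring and
there is a normalized trace onto the centre, then `1` is a sum of products of such elements. -/
theorem exists_sum_mul_eq_one {R : Type*} [Ring R] (θ : R ≃+* R) (T : R →+ R) (hT : T 1 = 1)
    (hTc : ∀ x t, t * T x = T x * t)
    (hTs : ∀ x s, (∀ t, t * s = s * t) → T (x * s) = T x * s)
    {k l : ℕ} (y w : Fin k → R) (y' w' : Fin l → R)
    (hw : ∀ i t, θ t * w i = w i * t) (hw' : ∀ i t, t * w' i = w' i * θ t)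
    (h : ∑ i, y i * w i = 1) (h' : ∑ i, y' i * w' i = 1) :
    ∃ (p q : Fin k × Fin l → R), (∀ i t, t * p i = p i * θ t) ∧
      (∀ i t, θ t * q i = q i * t) ∧ ∑ i, p i * q i = 1 := by
  -- Substituting `∑ y' j * w' j = 1` between `y i` and `w i` gives `1 = ∑ (y i * y' j) * (w' j * w
  -- i)`. The second factor is central because the two twists cancel, so `T` pulls it out, leaving a
  -- central coefficient on `w' j`.
  refine ⟨fun i => T (y i.1 * y' i.2) * w' i.2, fun i => w i.1, ?_, fun i => hw i.1, ?_⟩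
  · intro i t
    rw [← mul_assoc, hTc, mul_assoc, hw', mul_assoc]
  · have key : ∑ i : Fin k × Fin l, (y i.1 * y' i.2) * (w' i.2 * w i.1) = 1 := by
      rw [Fintype.sum_prod_type, ← h]
      refine Finset.sum_congr rfl fun i _ => ?_
      calc ∑ j, y i * y' j * (w' j * w i) = y i * (∑ j, y' j * w' j) * w i := by
            simp only [Finset.mul_sum, Finset.sum_mul, mul_assoc]
        _ = y i * w i := by rw [h', mul_one]
    rw [← hT, ← key, map_sum]
    refine Finset.sum_congr rfl fun i _ => ?_
    rw [hTs, mul_assoc]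
    intro t
    rw [← mul_assoc, hw', mul_assoc, hw, mul_assoc]

/-! ### Casimir elements and twisted traces -/

section Trace

open MonObj

variable {C : Type u} [Category.{v} C] [MonoidalCategory C] {A : C} [MonObj A]

/-- The element `∑ κ(e¹) x e²` of `Z(A)`, where `e = g ∘ u`. -/
noncomputable def twistedTrace (κ : A ⟶ A) (g : A ⟶ A ⊗ A) (x : 𝟙_ C ⟶ A) : 𝟙_ C ⟶ A :=
  η[A] ≫ g ≫ conv (ract κ x) (𝟙 A)

theorem twistedTrace_add [Preadditive C] [MonoidalPreadditive C] (κ : A ⟶ A) (g : A ⟶ A ⊗ A)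
    (x y : 𝟙_ C ⟶ A) : twistedTrace κ g (x + y) = twistedTrace κ g x + twistedTrace κ g y := by
  simp [twistedTrace, ract, conv_add, add_conv]

/-- In `∑ κ(e¹) x s e²` the factor `s` moves past `e²`. This needs `s` to commute with all of `A`,
not only with `Z(A)`. -/
theorem twistedTrace_ract (κ : A ⟶ A) (g : A ⟶ A ⊗ A) (x s : 𝟙_ C ⟶ A)
    (hs : lact s (𝟙 A) = ract (𝟙 A) s) :
    twistedTrace κ g (ract x s) = ract (twistedTrace κ g x) s := by
  rw [twistedTrace, ← ract_ract, ← conv_lact, hs, ← ract_conv, comp_ract, comp_ract]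
  rfl

/-- Bimodule morphisms `A ⊗ A ⟶ A` are given by `a ⊗ b ↦ a z b` for some `z` in `Z(A)`. -/
theorem exists_eq_conv_ract {f : A ⊗ A ⟶ A}
    (hl : ((α_ A A A).inv ≫ μ[A] ▷ A) ≫ f = A ◁ f ≫ μ[A])
    (hr : ((α_ A A A).hom ≫ A ◁ μ[A]) ≫ f = f ▷ A ≫ μ[A]) :
    ∃ z : 𝟙_ C ⟶ A, f = conv (ract (𝟙 A) z) (𝟙 A) := by
  -- A bimodule map out of `A ⊗ A` is determined by its value at `1 ⊗ 1`.
  refine ⟨(λ_ _).inv ≫ (η[A] ⊗ₘ η[A]) ≫ f, ?_⟩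
  have h1 : ract (𝟙 A) ((λ_ (𝟙_ C)).inv ≫ (η[A] ⊗ₘ η[A]) ≫ f) =
      (ρ_ A).inv ≫ A ◁ η[A] ≫ f := by
    simp only [ract, conv, id_tensorHom, MonoidalCategory.whiskerLeft_comp, Category.assoc]
    rw [← hl, MonoidalCategory.tensorHom_def', MonoidalCategory.whiskerLeft_comp]
    simp only [Category.assoc]
    rw [associator_inv_naturality_middle_assoc, ← comp_whiskerRight_assoc, MonObj.mul_one]
    simp
  rw [h1, conv, tensorHom_id, comp_whiskerRight, comp_whiskerRight, Category.assoc,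
    Category.assoc, ← hr]
  simp only [Category.assoc]
  rw [associator_naturality_middle_assoc, ← MonoidalCategory.whiskerLeft_comp_assoc,
    MonObj.one_mul]
  simp

variable {g : A ⟶ A ⊗ A}

/-- Left linearity gives `g(a) = a e`, so `κ(a) ∑ κ(e¹) x e² = ∑ κ(a e¹) x e²` is a function of
`g(a)`. Right linearity gives the same function from the other side in `twistedTrace_lact`;
comparing the two yields the intertwining relation. -/
theorem ract_twistedTrace (hg : μ[A] ≫ g = A ◁ g ≫ (α_ A A A).inv ≫ μ[A] ▷ A)
    (κ : A ⟶ A) [IsMonHom κ] (x : 𝟙_ C ⟶ A) :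
    ract κ (twistedTrace κ g x) = g ≫ conv (ract κ x) (𝟙 A) := by
  have hκ : conv κ κ = μ[A] ≫ κ := by simp [conv]
  have h : conv κ (g ≫ conv (ract κ x) (𝟙 A)) = μ[A] ≫ g ≫ conv (ract κ x) (𝟙 A) := by
    rw [reassoc_of% hg, whiskerRight_conv, comp_ract, ← hκ, ract_conv, conv_assoc_inv,
      whiskerLeft_conv]
  rw [twistedTrace, ract, ← whiskerLeft_conv, h, MonObj.mul_one_assoc, Iso.inv_hom_id_assoc]

theorem twistedTrace_lact (hg : μ[A] ≫ g = g ▷ A ≫ (α_ A A A).hom ≫ A ◁ μ[A])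
    (κ : A ⟶ A) (x : 𝟙_ C ⟶ A) :
    lact (twistedTrace κ g x) (𝟙 A) = g ≫ conv (ract κ x) (𝟙 A) := by
  have hμ : conv (𝟙 A) (𝟙 A) = μ[A] := by simp [conv]
  have h : conv (g ≫ conv (ract κ x) (𝟙 A)) (𝟙 A) =
      μ[A] ≫ g ≫ conv (ract κ x) (𝟙 A) := by
    rw [reassoc_of% hg, whiskerLeft_conv, Category.comp_id, ← hμ, conv_assoc, whiskerRight_conv]
  rw [twistedTrace, lact, ← whiskerRight_conv, h, MonObj.one_mul_assoc, Iso.inv_hom_id_assoc]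

/-- The twisted traces intertwine `κ` and the identity. -/
theorem lact_twistedTrace (hl : μ[A] ≫ g = A ◁ g ≫ (α_ A A A).inv ≫ μ[A] ▷ A)
    (hr : μ[A] ≫ g = g ▷ A ≫ (α_ A A A).hom ≫ A ◁ μ[A]) (κ : A ⟶ A) [IsMonHom κ] (x t : 𝟙_ C ⟶ A) :
    lact (t ≫ κ) (twistedTrace κ g x) = lact (twistedTrace κ g x) t := by
  rw [lact_eq_ract, ← comp_ract, ract_twistedTrace hl, ← twistedTrace_lact hr, comp_lact,
    Category.comp_id]

end Trace

/-! ### Morita contexts with values in the unit object -/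

section Morita

open MonObj

variable {C : Type u} [Category.{v} C] [MonoidalCategory C] {A : C} [MonObj A]

/-- The usual argument that a surjective Morita pairing is injective: if `n = ∑ xᵢ ⊗ yᵢ` and `∑ xᵢ
yᵢ = 1`, then `m(p) n = p · m(n) = p` for every `p` in `X ⊗ Y`. The associativity of the context is
inherited from `A` because `i` and `j` are monomorphisms. -/
theorem section_isInverse {X Y : C} {i : X ⟶ A} {j : Y ⟶ A} [Mono i] [Mono j]
    (m : X ⊗ Y ⟶ 𝟙_ C) (m' : Y ⊗ X ⟶ 𝟙_ C) (hm : m ≫ η[A] = conv i j)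
    (hm' : m' ≫ η[A] = conv j i) (n : 𝟙_ C ⟶ X ⊗ Y) (hn : n ≫ m = 𝟙 _) :
    m ≫ n = 𝟙 _ := by
  have h1 : m ▷ X ≫ (λ_ X).hom = (α_ X Y X).hom ≫ X ◁ m' ≫ (ρ_ X).hom := by
    rw [← cancel_mono i]
    simp only [Category.assoc]
    rw [← one_conv, ← conv_one, whiskerRight_conv, whiskerLeft_conv, hm, hm', conv_assoc]
  have h2 : m' ▷ Y ≫ (λ_ Y).hom = (α_ Y X Y).hom ≫ Y ◁ m ≫ (ρ_ Y).hom := by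
    rw [← cancel_mono j]
    simp only [Category.assoc]
    rw [← one_conv, ← conv_one, whiskerRight_conv, whiskerLeft_conv, hm, hm', conv_assoc]
  -- On `X ⊗ Y ⊗ X ⊗ Y`, evaluating the first pair or the last pair gives the same result: both
  -- equal the evaluation of the middle pair by `m'`.
  have h3 : m ▷ (X ⊗ Y) ≫ (λ_ (X ⊗ Y)).hom = (X ⊗ Y) ◁ m ≫ (ρ_ (X ⊗ Y)).hom := by
    have e1 : m ▷ (X ⊗ Y) ≫ (λ_ (X ⊗ Y)).hom =
        (α_ (X ⊗ Y) X Y).inv ≫ (m ▷ X ≫ (λ_ X).hom) ▷ Y := by simp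
    have e2 : (X ⊗ Y) ◁ m ≫ (ρ_ (X ⊗ Y)).hom =
        (α_ X Y (X ⊗ Y)).hom ≫ X ◁ (Y ◁ m ≫ (ρ_ Y).hom) := by simp
    have e3 : Y ◁ m ≫ (ρ_ Y).hom = (α_ Y X Y).inv ≫ m' ▷ Y ≫ (λ_ Y).hom := by
      rw [h2, Iso.inv_hom_id_assoc]
    rw [e1, e2, e3, h1]
    simp
  calc m ≫ n = (ρ_ (X ⊗ Y)).inv ≫ (X ⊗ Y) ◁ n ≫ m ▷ (X ⊗ Y) ≫ (λ_ (X ⊗ Y)).hom := by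
        rw [whisker_exchange_assoc]
        simp
        rw [← unitors_inv_equal, Iso.inv_hom_id_assoc]
    _ = (ρ_ (X ⊗ Y)).inv ≫ (X ⊗ Y) ◁ (n ≫ m) ≫ (ρ_ (X ⊗ Y)).hom := by rw [h3]; simp
    _ = 𝟙 _ := by rw [hn]; simp

/-- A context whose two products cover the unit is an invertibility datum. -/
def InvDatum.ofSections [Mono η[A]] {X Y : C} {i : X ⟶ A} {j : Y ⟶ A} [Mono i] [Mono j]
    (m : X ⊗ Y ⟶ 𝟙_ C) (m' : Y ⊗ X ⟶ 𝟙_ C) (hm : m ≫ η[A] = conv i j)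
    (hm' : m' ≫ η[A] = conv j i) (n : 𝟙_ C ⟶ X ⊗ Y) (n' : 𝟙_ C ⟶ Y ⊗ X)
    (hn : n ≫ conv i j = η[A]) (hn' : n' ≫ conv j i = η[A]) : InvDatum i j :=
  have h : n ≫ m = 𝟙 _ := by
    rw [← cancel_mono η[A], Category.assoc, hm, hn, Category.id_comp]
  have h' : n' ≫ m' = 𝟙 _ := by
    rw [← cancel_mono η[A], Category.assoc, hm', hn', Category.id_comp]
  { mX := ⟨m, n, section_isInverse m m' hm hm' n h, h⟩
    mY := ⟨m', n', section_isInverse m' m hm' hm n' h', h'⟩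
    hX := hm
    hY := hm' }

end Morita

/-! ### The subobjects `J`, and the image and kernel of the Miyashita action -/

section Subobjects

open MonObj

variable {C : Type u} [Category.{v} C] [Abelian C] [MonoidalCategory C]
  [WellPowered.{v} C] [HasLimits C] {A : C} [MonObj A]

theorem J_congr {σ δ σ' δ' : (𝟙_ C ⟶ A) → (𝟙_ C ⟶ A)}
    (h : ∀ {X : C} (f : X ⟶ A), (∀ t, lact (σ t) f = ract f (δ t)) →
      ∀ t, lact (σ' t) f = ract f (δ' t)) : J σ δ ≤ J σ' δ' :=
  Subobject.le_of_comm ((J σ' δ').factorThru (J σ δ).arrow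
    ((J_factors_iff _ _ _).2 (h _ (lact_J_arrow σ δ)))) (Subobject.factorThru_arrow _ _ _)

/-- A surjective `σ` only reindexes the commutation conditions. -/
theorem J_self {σ : (𝟙_ C ⟶ A) → (𝟙_ C ⟶ A)} (hσ : Function.Surjective σ) :
    J σ σ = J (A := A) id id :=
  le_antisymm
    (J_congr fun f h t => by obtain ⟨s, rfl⟩ := hσ t; exact h s)
    (J_congr fun f h t => h (σ t))

theorem unitJ_mulJ (σ δ : (𝟙_ C ⟶ A) → (𝟙_ C ⟶ A)) :
    unitJ σ ▷ (J σ δ : C) ≫ mulJ σ σ δ = (λ_ _).hom := by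
  rw [← cancel_mono (J σ δ).arrow, Category.assoc, mulJ_arrow, whiskerRight_conv, unitJ_arrow,
    one_conv]

theorem mulJ_unitJ (σ δ : (𝟙_ C ⟶ A) → (𝟙_ C ⟶ A)) :
    (J σ δ : C) ◁ unitJ δ ≫ mulJ σ δ δ = (ρ_ _).hom := by
  rw [← cancel_mono (J σ δ).arrow, Category.assoc, mulJ_arrow, whiskerLeft_conv, unitJ_arrow,
    conv_one]

/-- Over a trivial `J δ δ` the balanced tensor product is the tensor product. -/
theorem isIso_mulJBar_iff {σ δ κ : (𝟙_ C ⟶ A) → (𝟙_ C ⟶ A)} [IsIso (unitJ (A := A) δ)] :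
    IsIso (mulJBar (A := A) σ δ κ) ↔ IsIso (mulJ (A := A) σ δ κ) := by
  have h : mulJ σ δ δ ▷ (J (A := A) δ κ : C) =
      (α_ (J σ δ : C) (J δ δ : C) (J δ κ : C)).hom ≫ (J σ δ : C) ◁ mulJ δ δ κ := by
    -- The two actions of `J δ δ` need only be compared on its unit, which is an isomorphism; there
    -- both are trivial.
    rw [← cancel_epi (((J σ δ : C) ◁ unitJ δ) ▷ (J δ κ : C)), ← comp_whiskerRight, mulJ_unitJ,
      associator_naturality_middle_assoc, ← MonoidalCategory.whiskerLeft_comp, unitJ_mulJ]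
    simp
  have hπ : IsIso (coequalizer.π (mulJ σ δ δ ▷ (J (A := A) δ κ : C))
      ((α_ (J σ δ : C) (J δ δ : C) (J δ κ : C)).hom ≫ (J σ δ : C) ◁ mulJ δ δ κ)) :=
    coequalizer.π_of_eq h
  have e : coequalizer.π _ _ ≫ mulJBar (A := A) σ δ κ = mulJ σ δ κ := coequalizer.π_desc _ _
  rw [← e]
  exact ⟨fun h => IsIso.comp_isIso' hπ h, fun _ => IsIso.of_isIso_comp_left (coequalizer.π _ _) _⟩

variable [IsIso (unitJ (A := A) id)]

/-- Morphisms commuting with all of `Z(A)` factor through the unit of `A`. -/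
theorem exists_comp_one_eq {X : C} (f : X ⟶ A) (hf : ∀ t : 𝟙_ C ⟶ A, lact t f = ract f t) :
    ∃ s : X ⟶ 𝟙_ C, s ≫ η[A] = f := by
  refine ⟨(J (A := A) id id).factorThru f ((J_factors_iff _ _ _).2 hf) ≫ inv (unitJ id), ?_⟩
  rw [Category.assoc, ← unitJ_arrow id, IsIso.inv_hom_id_assoc, Subobject.factorThru_arrow]

theorem isIso_unitJ {σ : (𝟙_ C ⟶ A) → (𝟙_ C ⟶ A)} (hσ : Function.Surjective σ) :
    IsIso (unitJ (A := A) σ) := by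
  have h : unitJ (A := A) σ = unitJ id ≫ (Subobject.isoOfEq _ _ (J_self hσ).symm).hom := by
    rw [← cancel_mono (J σ σ).arrow]
    simp [unitJ_arrow]
  rw [h]
  infer_instance

/-- Sections of the products of `J σ 1` and `J 1 σ` make them mutually inverse. -/
theorem nonempty_invDatum_J {σ : (𝟙_ C ⟶ A) → (𝟙_ C ⟶ A)} (hσ : Function.Surjective σ)
    (n : 𝟙_ C ⟶ (J σ id : C) ⊗ (J id σ : C)) (n' : 𝟙_ C ⟶ (J id σ : C) ⊗ (J σ id : C))
    (hn : n ≫ conv (J σ id).arrow (J id σ).arrow = η[A])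
    (hn' : n' ≫ conv (J id σ).arrow (J σ id).arrow = η[A]) :
    Nonempty (InvDatum (J σ id).arrow (J (A := A) id σ).arrow) := by
  have := isIso_unitJ hσ
  refine ⟨InvDatum.ofSections (mulJ σ id σ ≫ inv (unitJ σ)) (mulJ id σ id ≫ inv (unitJ id))
    ?_ ?_ n n' hn hn'⟩
  · rw [Category.assoc, ← unitJ_arrow σ, IsIso.inv_hom_id_assoc, mulJ_arrow]
  · rw [Category.assoc, ← unitJ_arrow id, IsIso.inv_hom_id_assoc, mulJ_arrow]

/-- Both balanced multiplications are isomorphisms if and only if `J σ 1` and `J 1 σ` are mutually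
inverse. -/
theorem isIso_mulJBar_and_iff {σ : (𝟙_ C ⟶ A) → (𝟙_ C ⟶ A)} (hσ : Function.Surjective σ) :
    IsIso (mulJBar (A := A) σ id σ) ∧ IsIso (mulJBar (A := A) id σ id) ↔
      Nonempty (InvDatum (J σ id).arrow (J (A := A) id σ).arrow) := by
  have := isIso_unitJ hσ
  rw [isIso_mulJBar_iff, isIso_mulJBar_iff]
  constructor
  · rintro ⟨h, h'⟩
    exact ⟨asIso (mulJ σ id σ) ≪≫ (asIso (unitJ σ)).symm,
      asIso (mulJ id σ id) ≪≫ (asIso (unitJ id)).symm,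
      by simp [← unitJ_arrow (A := A) σ, mulJ_arrow],
      by simp [← unitJ_arrow (A := A) id, mulJ_arrow]⟩
  · rintro ⟨d⟩
    have h : mulJ σ id σ = d.mX.hom ≫ unitJ (A := A) σ := by
      rw [← cancel_mono (J σ σ).arrow, mulJ_arrow, Category.assoc, unitJ_arrow, d.hX]
    have h' : mulJ id σ id = d.mY.hom ≫ unitJ (A := A) id := by
      rw [← cancel_mono (J id id).arrow, mulJ_arrow, Category.assoc, unitJ_arrow, d.hY]
    rw [h, h']
    exact ⟨inferInstance, inferInstance⟩

variable [MonoidalPreadditive C]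

theorem mem_invertibleAuts_iff (θ : AutZ A) :
    θ ∈ invertibleAuts A ↔ Nonempty (InvDatum (A := A) (J θ id).arrow (J id θ).arrow) :=
  isIso_mulJBar_and_iff (A := A) (σ := θ) θ.surjective

variable [Penrose C]

theorem range_Phi : ((Phi A).range : Set (AutZ A)) = invertibleAuts A := by
  ext θ
  rw [mem_invertibleAuts_iff]
  constructor
  · rintro ⟨X, rfl⟩
    obtain ⟨Y, ⟨d⟩⟩ := X.2
    have h : ∀ t : 𝟙_ C ⟶ A, lact (Phi A X t) X.1.arrow = ract X.1.arrow t := fun t => by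
      rw [Phi_apply X d]
      exact d.lact_sigma t
    have h' : ∀ t : 𝟙_ C ⟶ A, lact t Y.arrow = ract Y.arrow (Phi A X t) := fun t => by
      rw [Phi_apply X d, ← d.symm.lact_sigma, d.sigma_symm]
    let a := (J (Phi A X) id).factorThru X.1.arrow ((J_factors_iff _ _ _).2 h)
    let b := (J id (Phi A X)).factorThru Y.arrow ((J_factors_iff _ _ _).2 h')
    -- Only sections are needed, so `X` and `Y` need not be compared further with the `J`'s
    -- containing them.
    refine nonempty_invDatum_J (Phi A X).surjective (d.mX.inv ≫ (a ⊗ₘ b)) (d.mY.inv ≫ (b ⊗ₘ a))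
      ?_ ?_
    · rw [Category.assoc, tensor_conv, Subobject.factorThru_arrow, Subobject.factorThru_arrow,
        ← d.hX, Iso.inv_hom_id_assoc]
    · rw [Category.assoc, tensor_conv, Subobject.factorThru_arrow, Subobject.factorThru_arrow,
        ← d.hY, Iso.inv_hom_id_assoc]
  · rintro ⟨d⟩
    refine ⟨⟨J θ id, J id θ, ⟨d⟩⟩, AlgEquiv.ext fun t => ?_⟩
    exact (Phi_apply _ d t).trans (d.sigma_unique (lact_J_arrow _ _ t))

theorem Phi_injective : Function.Injective (Phi A) := by
  rw [injective_iff_map_eq_one]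
  intro X hX
  obtain ⟨Y, ⟨d⟩⟩ := X.2
  have hσ : ∀ t, d.sigma t = t := fun t => by
    rw [← Phi_apply X d, hX]
    rfl
  obtain ⟨s, hs⟩ := exists_comp_one_eq X.1.arrow fun t => by
    conv_lhs => rw [← hσ t]
    exact d.lact_sigma t
  obtain ⟨r, hr⟩ := exists_comp_one_eq Y.arrow fun t => by
    conv_rhs => rw [← hσ t]
    rw [← d.symm.lact_sigma, d.sigma_symm]
  -- `X` is contained in the unit object through the monomorphism `s`; the composite `𝟙 ≅ X ⊗ Y ⟶ X
  -- ⊗ 𝟙 ≅ X` splits it.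
  have hsec : (d.mX.inv ≫ (X.1 : C) ◁ r ≫ (ρ_ _).hom) ≫ s = 𝟙 _ := by
    rw [← cancel_mono η[A]]
    simp only [Category.assoc]
    rw [hs, ← conv_one, whiskerLeft_conv, hr, ← d.hX, Iso.inv_hom_id_assoc, Category.id_comp]
  have : Mono s := by
    have : Mono (s ≫ η[A]) := by rw [hs]; infer_instance
    exact mono_of_mono s η[A]
  have hs' : s ≫ (d.mX.inv ≫ (X.1 : C) ◁ r ≫ (ρ_ _).hom) = 𝟙 _ := by
    rw [← cancel_mono s, Category.assoc, hsec, Category.comp_id, Category.id_comp]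
  apply Subtype.ext
  rw [one_val]
  conv_lhs => rw [← Subobject.mk_arrow X.1]
  exact Subobject.mk_eq_mk_of_comm _ _ ⟨s, d.mX.inv ≫ (X.1 : C) ◁ r ≫ (ρ_ _).hom, hs', hsec⟩ hs

end Subobjects

/-! ### Consequences of `A ⊗ A ∼ A` for `Z(A)` -/

section Divisibility

open MonObj

theorem scalar_lact_id {C : Type u} [Category.{v} C] [MonoidalCategory C] {A : C} [MonObj A] [Penrose C]
    (s : 𝟙_ C ⟶ 𝟙_ C) :
    lact (s ≫ η[A]) (𝟙 A) = ract (𝟙 A) (s ≫ η[A]) := by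
  have h := Penrose.central s (𝟙 A)
  simp only [tensorHom_id, id_tensorHom] at h
  rw [lact, ract, ← whiskerRight_conv, ← whiskerLeft_conv, one_conv, conv_one]
  simpa using h

variable {C : Type u} [Category.{v} C] [Preadditive C] [MonoidalCategory C]
  [MonoidalPreadditive C] {A : C} [MonObj A]

/-- If `A ⊗ A` divides `A` then `1` is a combination of elements intertwining `κ` and the
identity. -/
theorem exists_sum_mul_intertwiner_eq_one
    (h : DividesBimod (tensorSelf A) (Bimod.regular (Mon.mk A))) (κ : A ⟶ A) [IsMonHom κ] :
    ∃ (k : ℕ) (y w : Fin k → Z A),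
      (∀ (i : Fin k) (t : 𝟙_ C ⟶ A), lact (A := A) (t ≫ κ) (w i) = lact (A := A) (w i) t) ∧
      ∑ i, y i * w i = 1 := by
  obtain ⟨k, -, f, g, hfg⟩ := h
  let f' : Fin k → (A ⊗ A ⟶ A) := fun i => (f i).hom
  let g' : Fin k → (A ⟶ A ⊗ A) := fun i => (g i).hom
  have hfg' : ∑ i, f' i ≫ g' i = 𝟙 (A ⊗ A) := hfg
  refine ⟨k, fun i => (((λ_ _).inv ≫ (η[A] ⊗ₘ η[A]) ≫ f' i) ≫ κ : 𝟙_ C ⟶ A),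
    fun i => twistedTrace κ (g' i) η[A],
    fun i t => lact_twistedTrace (A := A) (g i).left_act_hom (g i).right_act_hom κ _ t, ?_⟩
  -- Each summand `κ(zᵢ) wᵢ` is the image of `zᵢ eᵢ = gᵢ(fᵢ(1 ⊗ 1))` under `a ⊗ b ↦ κ(a) b`.
  have key : ∀ i, lact (((λ_ _).inv ≫ (η[A] ⊗ₘ η[A]) ≫ f' i) ≫ κ) (twistedTrace κ (g' i) η[A]) =
      (λ_ _).inv ≫ (η[A] ⊗ₘ η[A]) ≫ (f' i ≫ g' i) ≫ conv κ (𝟙 A) := fun i => by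
    rw [lact_eq_ract, ← comp_ract, ract_twistedTrace (A := A) (g := g' i) (g i).left_act_hom, ract_one]
    simp only [Category.assoc]
  have hsum : ∑ i, lact (((λ_ _).inv ≫ (η[A] ⊗ₘ η[A]) ≫ f' i) ≫ κ)
      (twistedTrace κ (g' i) η[A]) = η[A] := by
    simp only [key]
    rw [← Preadditive.comp_sum, ← Preadditive.comp_sum, ← Preadditive.sum_comp, hfg',
      Category.id_comp, tensor_conv, IsMonHom.one_hom, Category.comp_id, one_conv,
      Iso.inv_hom_id_assoc]
  exact hsum

/-- If `A` divides `A ⊗ A` then `Z(A)` has a normalized trace onto its centre. -/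
theorem exists_trace (h : DividesBimod (Bimod.regular (Mon.mk A)) (tensorSelf A)) :
    ∃ T : Z A →+ Z A, T 1 = 1 ∧ (∀ x t, t * T x = T x * t) ∧
      ∀ x s : Z A, (∀ t, t * s = s * t) → lact (A := A) s (𝟙 A) = ract (A := A) (𝟙 A) s →
        T (x * s) = T x * s := by
  obtain ⟨k, -, f, g, hfg⟩ := h
  let f' : Fin k → (A ⟶ A ⊗ A) := fun i => (f i).hom
  let g' : Fin k → (A ⊗ A ⟶ A) := fun i => (g i).hom
  have hfg' : ∑ i, f' i ≫ g' i = 𝟙 A := hfg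
  have hg : ∀ i, ∃ z : 𝟙_ C ⟶ A, g' i = conv (ract (𝟙 A) z) (𝟙 A) := fun i =>
    exists_eq_conv_ract (g i).left_act_hom (g i).right_act_hom
  choose z hz using hg
  let z' : Fin k → Z A := z
  let τ : Fin k → Z A →+ Z A := fun i =>
    { toFun := fun x => twistedTrace (𝟙 A) (f' i) x
      map_zero' := by
        have h := twistedTrace_add (𝟙 A) (f' i) 0 0
        rw [add_zero, left_eq_add] at h
        exact h
      map_add' := fun x y => twistedTrace_add (𝟙 A) (f' i) x y }
  -- The trace is `T x = ∑ eᵢ¹ x zᵢ eᵢ²`, with `eᵢ = f' i (1)`; at `x = 1` it is `∑ g' i (f' i (1))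
  -- = 1`.
  refine ⟨∑ i, (τ i).comp (AddMonoidHom.mulRight (z' i)), ?_, ?_, ?_⟩
  · rw [AddMonoidHom.finsetSum_apply]
    have key : ∀ i, twistedTrace (𝟙 A) (f' i) (z i) = η[A] ≫ f' i ≫ g' i := fun i => by
      rw [hz]
      rfl
    have hsum : ∑ i, twistedTrace (𝟙 A) (f' i) (z i) = η[A] := by
      simp only [key]
      rw [← Preadditive.comp_sum, hfg', Category.comp_id]
    refine Eq.trans (Finset.sum_congr rfl fun i _ => ?_) hsum
    exact congrArg (τ i) (one_mul (z' i))
  · intro x t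
    rw [AddMonoidHom.finsetSum_apply, Finset.mul_sum, Finset.sum_mul]
    refine Finset.sum_congr rfl fun i _ => ?_
    have key := lact_twistedTrace (A := A) (g := f' i) (f i).left_act_hom (f i).right_act_hom
      (𝟙 A) (x * z' i) t
    exact (congrArg (fun s => lact s _) (Category.comp_id _).symm).trans key
  · intro x s hs hs'
    rw [AddMonoidHom.finsetSum_apply, AddMonoidHom.finsetSum_apply, Finset.sum_mul]
    refine Finset.sum_congr rfl fun i _ => ?_
    have key : ∀ y s : 𝟙_ C ⟶ A, lact s (𝟙 A) = ract (𝟙 A) s →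
        twistedTrace (𝟙 A) (f' i) (lact y s) = lact (twistedTrace (𝟙 A) (f' i) y) s :=
      fun y s h => by
        rw [lact_eq_ract, lact_eq_ract]
        exact twistedTrace_ract (𝟙 A) (f' i) y s h
    refine Eq.trans (congrArg (τ i) ?_) (key (x * z' i) s hs')
    -- Centrality in `Z(A)` moves `s` past `zᵢ`; commutation with `A` has already moved it past
    -- `eᵢ²`.
    change x * s * z' i = x * z' i * s
    rw [_root_.mul_assoc, ← hs, _root_.mul_assoc]

end Divisibility

/-! ### The image of `Ω`, and the theorem -/

section Main

open MonObj

variable {C : Type u} [Category.{v} C] [Abelian C] [MonoidalCategory C]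
  [WellPowered.{v} C] [HasLimits C] {A : C} [MonObj A]

/-- A decomposition of `1` into products yields a section of the multiplication of the `J`'s. -/
theorem exists_section {σ δ κ : (𝟙_ C ⟶ A) → (𝟙_ C ⟶ A)} {I : Type*} [Fintype I] (p q : I → (𝟙_ C ⟶ A))
    (hp : ∀ (i : I) (t : 𝟙_ C ⟶ A), lact (σ t) (p i) = lact (p i) (δ t))
    (hq : ∀ (i : I) (t : 𝟙_ C ⟶ A), lact (δ t) (q i) = lact (q i) (κ t))
    (h : ∑ i, lact (p i) (q i) = η[A]) :
    ∃ n : 𝟙_ C ⟶ (J σ δ : C) ⊗ (J δ κ : C),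
      n ≫ conv (J σ δ).arrow (J δ κ).arrow = η[A] := by
  refine ⟨∑ i, (λ_ _).inv ≫
    ((J σ δ).factorThru (p i) ((J_factors_iff _ _ _).2 fun t => (hp i t).trans (lact_eq_ract _ _))
      ⊗ₘ (J δ κ).factorThru (q i)
        ((J_factors_iff _ _ _).2 fun t => (hq i t).trans (lact_eq_ract _ _))), ?_⟩
  rw [Preadditive.sum_comp]
  refine Eq.trans (Finset.sum_congr rfl fun i _ => ?_) h
  rw [Category.assoc, tensor_conv, Subobject.factorThru_arrow, Subobject.factorThru_arrow]
  rfl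

variable [MonoidalPreadditive C] [Penrose C] [IsIso (unitJ (A := A) id)]

theorem Omega_mem_invertibleAuts
    (hAA : SimilarBimod (tensorSelf A) (Bimod.regular (Mon.mk A))) (φ : AutAlg A) :
    Omega A φ ∈ invertibleAuts A := by
  obtain ⟨T, hT, hTc, hTs⟩ := exists_trace hAA.2
  -- A central element of `Z(A)` is a scalar because `J 1 1` is the unit object, and the Penrose
  -- condition makes scalars commute with all of `A`.
  have hTs' : ∀ x s : Z A, (∀ t, t * s = s * t) → T (x * s) = T x * s := fun x s hs => by
    obtain ⟨r, hr⟩ := exists_comp_one_eq (A := A) s fun t =>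
      (hs t).trans (lact_eq_ract _ _)
    exact hTs x s hs (hr ▸ scalar_lact_id r)
  obtain ⟨k, y, w, hw, h⟩ := exists_sum_mul_intertwiner_eq_one hAA.1 φ.hom.hom
  obtain ⟨k', y', w', hw', h'⟩ := exists_sum_mul_intertwiner_eq_one hAA.1 φ.inv.hom
  let θ : Z A ≃+* Z A := (Omega A φ).toRingEquiv
  have e1 : ∀ i t, θ t * w i = w i * t := hw
  have e1' : ∀ i t, θ.symm t * w' i = w' i * t := hw'
  have e2 : ∀ i t, t * w i = w i * θ.symm t := fun i t => by rw [← e1, θ.apply_symm_apply]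
  have e2' : ∀ i t, t * w' i = w' i * θ t := fun i t => by rw [← e1', θ.symm_apply_apply]
  -- The ring lemma is used for `θ` and for `θ⁻¹`, since the multiplications `J 1 θ ⊗ J θ 1` and `J
  -- θ 1 ⊗ J 1 θ` each need a section.
  obtain ⟨p, q, hp, hq, hpq⟩ := exists_sum_mul_eq_one θ T hT hTc hTs' y w y' w' e1 e2' h h'
  obtain ⟨p', q', hp', hq', hpq'⟩ := exists_sum_mul_eq_one θ.symm T hT hTc hTs' y' w' y w
    e1' e2 h' h
  have hp2 : ∀ i t, θ t * p' i = p' i * t := fun i t => by rw [hp', θ.symm_apply_apply]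
  have hq2 : ∀ i t, t * q' i = q' i * θ t := fun i t => by rw [← hq', θ.symm_apply_apply]
  obtain ⟨n, hn⟩ := exists_section (A := A) (σ := id) (δ := θ) (κ := id) p q hp hq hpq
  obtain ⟨n', hn'⟩ := exists_section (A := A) (σ := θ) (δ := id) (κ := θ) p' q' hp2 hq2 hpq'
  rw [mem_invertibleAuts_iff]
  exact nonempty_invDatum_J (Omega A φ).surjective n' n hn' hn

end Main

end Miyashita

theorem mainTheorem2 {C : Type u} [Category.{v} C] [Abelian C] [MonoidalCategory C]
    [MonoidalPreadditive C] [Penrose C] [WellPowered.{v} C] [HasLimits C] [HasColimits C]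
    [∀ X : C, PreservesFiniteColimits (tensorLeft X)]
    [∀ X : C, PreservesFiniteColimits (tensorRight X)]
    (A : C) [MonObj A] [PreservesFiniteLimits (tensorLeft A)]
    (hAA : SimilarBimod (tensorSelf A) (Bimod.regular (Mon.mk A)))
    [IsIso (unitJ (A := A) id)] :
    ∃ (G : Subgroup (AutZ A)) (ω : AutAlg A →* G),
      (G : Set (AutZ A)) = invertibleAuts A ∧
      (∀ γ : AutAlg A, (ω γ : AutZ A) = Omega A γ) ∧
      (Function.Surjective (Omega A) →
        Function.Bijective G.subtype ∧ Function.Bijective (Phi A)) ∧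
      (Function.Surjective (Omega A) → (preadditiveCoyonedaObj (𝟙_ C)).Faithful →
        Function.Bijective (Omega A) ∧ Function.Bijective ω ∧
        Nonempty (InvSub A ≃* AutZ A) ∧ Nonempty (AutZ A ≃* AutAlg A) ∧
        Nonempty (AutAlg A ≃* G)) := by
  have hG : ((Phi A).range : Set (AutZ A)) = invertibleAuts A := range_Phi
  have hΩ : ∀ γ, Omega A γ ∈ (Phi A).range := fun γ => by
    rw [← SetLike.mem_coe, hG]
    exact Omega_mem_invertibleAuts hAA γ
  have h1 : Function.Surjective (Omega A) →
      Function.Bijective (Phi A).range.subtype ∧ Function.Bijective (Phi A) := fun hs => by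
    have htop : ∀ θ, θ ∈ (Phi A).range := fun θ => by
      obtain ⟨γ, rfl⟩ := hs θ
      exact hΩ γ
    exact ⟨⟨Subtype.val_injective, fun θ => ⟨⟨θ, htop θ⟩, rfl⟩⟩, Phi_injective, htop⟩
  refine ⟨(Phi A).range, (Omega A).codRestrict _ hΩ, hG, fun _ => rfl, h1, fun hs hZ => ?_⟩
  have hΩb : Function.Bijective (Omega A) := by
    refine ⟨fun γ γ' h => ?_, hs⟩
    apply Iso.ext
    apply Mon.Hom.ext
    apply (preadditiveCoyonedaObj (𝟙_ C)).map_injective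
    ext z
    exact congrArg (fun θ : AutZ A => θ z) h
  have hω : Function.Bijective ((Omega A).codRestrict (Phi A).range hΩ) :=
    ⟨fun γ γ' h => hΩb.1 (congrArg Subtype.val h), fun θ => by
      obtain ⟨γ, hγ⟩ := hs θ.1
      exact ⟨γ, Subtype.ext hγ⟩⟩
  exact ⟨hΩb, hω, ⟨MulEquiv.ofBijective _ (h1 hs).2⟩, ⟨(MulEquiv.ofBijective _ hΩb).symm⟩,
    ⟨MulEquiv.ofBijective _ hω⟩⟩
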